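/- **Theorem (quantum Hebbian learning using bcQSE).** *Setting.* Let $N\ge 0$, $M\ge 1$, $d=2^N$, and let $|x^{(1)}\rangle,\dots,|x^{(M)}\rangle$ be pure states of $N$ qubits (unit vectors of $\mathbb C^d$). Put $$\rho=\frac1M\sum_{m=1}^M|x^{(m)}\rangle\langle x^{(m)}|,\qquad W=\rho-\frac{\mathbb I_d}{d}.$$ The working register consists of one learning qubit and $N$ processing qubits. For a fresh register of $N$ data qubits let $\mathcal S$ be the swap of processing and data qubits; the controlled partial swap for time $\tau$ with one copy of $|x^{(m)}\rangle$ is the channel $$\sigma\mapsto \mathrm{Tr}_{\rm data}\big[V(\sigma\otimes|x^{(m)}\rangle\langle x^{(m)}|)V^\dagger\big],\qquad V=e^{-i\tau|1\rangle\langle1|\otimes\mathcal S},$$ on the working register, where $|1\rangle\langle 1|$ acts on the learning qubit. A batch for time $\Delta t$ consists of $M$ controlled partial swaps, each for time $\Delta t/M$, with $|x^{(1)}\rangle,\dots,|x^{(M)}\rangle$ in this order. For real $t$ and $n\ge1$, *bcQSE for time $t$ with $n$ batches* performs $n$ batches for time $\Delta t=t/n$; *bcQSE with phases* also applies the conditional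 phase $P_{\Delta t}=e^{i\Delta t|1\rangle\langle1|\otimes\mathbb I_d/d}$ after each batch. Channels are compared in the diamond norm $\|\Phi\|_\diamond=\sup_k\sup_{\|X\|_1\le1}\|(\Phi\otimes \mathrm{id}_k)(X)\|_1$, and a channel is said to enact a unitary $U$ to error $\epsilon$ if its diamond distance from $\sigma\mapsto U\sigma U^\dagger$ is at most $\epsilon$. *Quantum Hebbian learning (QHL)* by a matrix $W$ and a family of programs (finite sequences of data-independent unitaries on the working register and data-independent joint unitaries with a fresh copy of some $|x^{(m)}\rangle$ that is then discarded) means: 1. $W$ is a quantum analogue of the classical Hebbian matrix: if $|x^{(m)}\rangle=d^{-1/2}\sum_i\xi^{(m)}_i|i\rangle$ with $\xi^{(m)}\in\{1,-1\}^d$ for all $m$, then $W_{ij}=\frac1{Md}\sum_m\xi^{(m)}_i\xi^{(m)}_j$ for $i\neq j$ and $W_{ii}=0$; 2. $W$ is operationally available: for all unit vectors $|x^{(m)}\rangle$, all $t\in\mathbb R$ and all $\epsilon>0$, the program for $(t,\epsilon)$ enacts $e^{-it|1\rangle\langle1|\otimes W}$ to error $\epsilon$ in diamond norm. *Claim.*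 There is a universal constant $C>0$ such that for all $N,M$ as above: * $W=\rho-\mathbb I_d/d$ and bcQSE with phases, with $n=\max(1,\lceil Ct^2/\epsilon\rceil)$ batches for given $(t,\epsilon)$, achieve QHL. With $n$ batches, bcQSE, with or without phases, uses exactly $n$ copies of each training state. * For all unit vectors $|x^{(m)}\rangle$, all $t\in\mathbb R$ and all $n\ge1$, bcQSE with $n$ batches enacts $e^{-it|1\rangle\langle1|\otimes\rho}$ to error $Ct^2/n$ in diamond norm, and bcQSE with phases enacts $e^{-it|1\rangle\langle1|\otimes W}$ to error $Ct^2/n$. If the phases are skipped, the latter is enacted to error $C\left(t^2/n+|t|/d\right)$. * For all $\Delta t\in\mathbb R$, in operator norm, $$\left\|e^{-i\Delta t|1\rangle\langle1|\otimes W}-e^{-i\Delta t|1\rangle\langle1|\otimes\rho}\,e^{i\Delta t|1\rangle\langle1|\otimes\mathbb I_d/d}\right\|\le C\,\Delta t^2 .$$ * The conditional phase acts on the learning qubit only, as a phase and a $Z$ rotation: $$e^{i\Delta t|1\rangle\langle1|\otimes\mathbb I_d/d}=\left(e^{i\Delta t/(2d)}\,e^{-i\frac{\Delta t}{2d}Z}\right)\otimes\mathbb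 I_d .$$ -/

import Mathlib

open scoped Kronecker ENNReal

noncomputable section

namespace QHL

/-! ### Trace norm, partial trace, diamond norm -/

section Norms

variable {a b : Type*} [Fintype a] [DecidableEq a] [Fintype b] [DecidableEq b]

/-- Operator norm of a square matrix, acting on the Euclidean space `ℂ^a`. -/
def opNorm (A : Matrix a a ℂ) : ℝ :=
  ‖Matrix.toEuclideanCLM (𝕜 := ℂ) A‖

/-- Trace norm: the sum of the singular values (square roots of the eigenvalues of `Aᴴ A`). -/
def traceNorm (A : Matrix a a ℂ) : ℝ :=
  ∑ i, Real.sqrt ((Matrix.isHermitian_conjTranspose_mul_self A).eigenvalues i)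

/-- Partial trace over the second tensor factor. -/
def traceRight (A : Matrix (a × b) (a × b) ℂ) : Matrix a a ℂ :=
  Matrix.of fun i j => ∑ q, A (i, q) (j, q)

/-- The map `Φ ⊗ id_k` on operators on `ℂ^a ⊗ ℂ^k`, where `Φ` is a linear map on operators
on `ℂ^a`. -/
def ampliate (Φ : Module.End ℂ (Matrix a a ℂ)) (k : ℕ) (X : Matrix (a × Fin k) (a × Fin k) ℂ) :
    Matrix (a × Fin k) (a × Fin k) ℂ :=
  Matrix.of fun i j => Φ (Matrix.of fun r s => X (r, i.2) (s, j.2)) i.1 j.1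

/-- Diamond norm: the supremum over all ancilla dimensions `k` of the norm of `Φ ⊗ id_k`
induced by the trace norm. -/
def diamondNorm (Φ : Module.End ℂ (Matrix a a ℂ)) : ℝ≥0∞ :=
  ⨆ (k : ℕ) (X : Matrix (a × Fin k) (a × Fin k) ℂ) (_ : traceNorm X ≤ 1),
    ENNReal.ofReal (traceNorm (ampliate Φ k X))

/-- The map `X ↦ U X Uᴴ`. -/
def conjBy (U : Matrix a a ℂ) : Module.End ℂ (Matrix a a ℂ) where
  toFun X := U * X * U.conjTranspose
  map_add' X Y := by rw [mul_add, add_mul]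
  map_smul' c X := by simp

/-- The channel `σ ↦ Tr_b (V (σ ⊗ τ) Vᴴ)`: adjoin a system in state `τ`, apply `V`, and discard
the adjoined system. -/
def interact (V : Matrix (a × b) (a × b) ℂ) (τ : Matrix b b ℂ) :
    Module.End ℂ (Matrix a a ℂ) where
  toFun σ := traceRight (V * (σ ⊗ₖ τ) * V.conjTranspose)
  map_add' X Y := by
    rw [Matrix.add_kronecker, mul_add, add_mul]
    ext i j
    simp [traceRight, Finset.sum_add_distrib]
  map_smul' c X := by
    rw [Matrix.smul_kronecker, Matrix.mul_smul, Matrix.smul_mul]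
    ext i j
    simp [traceRight, Finset.mul_sum]

/-- Time evolution `e^{-i t H}`. -/
def evolve (H : Matrix a a ℂ) (t : ℝ) : Matrix a a ℂ :=
  NormedSpace.exp ((-(Complex.I * t)) • H)

theorem evolve_mem_unitaryGroup {H : Matrix a a ℂ} (hH : H.IsHermitian) (t : ℝ) :
    evolve H t ∈ Matrix.unitaryGroup a ℂ := by
  have h : ((-(Complex.I * t)) • H).conjTranspose = -((-(Complex.I * t)) • H) := by
    rw [Matrix.conjTranspose_smul, hH.eq]
    simp
  rw [Matrix.mem_unitaryGroup_iff, Matrix.star_eq_conjTranspose, evolve,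
    ← Matrix.exp_conjTranspose, h, ← Matrix.exp_add_of_commute]
  · simp
  · exact (Commute.refl ((-(Complex.I * t)) • H)).neg_right

end Norms

/-! ### Qubits -/

/-- Computational basis of `N` qubits; it has `d = 2 ^ N` elements. -/
abbrev Basis (N : ℕ) := Fin N → Fin 2

/-- Vectors of `N` qubits. The pure states are those of norm one. -/
abbrev Ket (N : ℕ) := EuclideanSpace ℂ (Basis N)

/-- Operators on `N` qubits. -/
abbrev Op (N : ℕ) := Matrix (Basis N) (Basis N) ℂ

/-- Basis of the working register: one learning qubit and `N` processing qubits. -/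
abbrev Work (N : ℕ) := Fin 2 × Basis N

/-- The rank-one operator `|ψ⟩⟨ψ|`. -/
def ketbra {N : ℕ} (ψ : Ket N) : Op N :=
  Matrix.of fun i j => ψ i * star (ψ j)

/-- `|1⟩⟨1| ⊗ H`, where the first factor is the learning qubit. -/
def controlled {b : Type*} (H : Matrix b b ℂ) : Matrix (Fin 2 × b) (Fin 2 × b) ℂ :=
  (Matrix.single 1 1 1 : Matrix (Fin 2) (Fin 2) ℂ) ⊗ₖ H

theorem controlled_isHermitian {b : Type*} {H : Matrix b b ℂ} (hH : H.IsHermitian) :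
    (controlled H).IsHermitian := by
  rw [Matrix.IsHermitian, controlled, Matrix.conjTranspose_kronecker, hH.eq]
  simp

/-- The swap operation on two systems of `N` qubits each. -/
def swap (N : ℕ) : Matrix (Basis N × Basis N) (Basis N × Basis N) ℂ :=
  Matrix.of fun p q => if p.1 = q.2 ∧ p.2 = q.1 then 1 else 0

/-- `|1⟩⟨1| ⊗ S` on learning, processing and data qubits, where `S` swaps processing and data
qubits. -/
def controlledSwap (N : ℕ) : Matrix (Work N × Basis N) (Work N × Basis N) ℂ :=
  Matrix.reindex (Equiv.prodAssoc _ _ _).symm (Equiv.prodAssoc _ _ _).symm (controlled (swap N))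

theorem controlledSwap_isHermitian (N : ℕ) : (controlledSwap N).IsHermitian := by
  have h : (swap N).IsHermitian := by
    ext p q
    simp only [swap, Matrix.conjTranspose_apply, Matrix.of_apply, apply_ite star, star_one,
      star_zero]
    congr 1
    exact propext ⟨fun h => ⟨h.2.symm, h.1.symm⟩, fun h => ⟨h.2.symm, h.1.symm⟩⟩
  exact (controlled_isHermitian h).submatrix _

/-! ### Quantum algorithms that consume copies of the training data -/

/-- One instruction: a gate on the working register that does not involve the data, or a unitary
acting jointly on the working register and one fresh copy of the `m`-th data state, which is
discarded afterwards. -/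
inductive Instr (N M : ℕ) : Type
  | gate (U : Matrix.unitaryGroup (Work N) ℂ) : Instr N M
  | consume (m : Fin M) (V : Matrix.unitaryGroup (Work N × Basis N) ℂ) : Instr N M

/-- A program is a finite list of instructions. It is chosen without knowledge of the data. -/
abbrev Program (N M : ℕ) := List (Instr N M)

/-- The effect of an instruction on density operators of the working register. -/
def Instr.run {N M : ℕ} (x : Fin M → Ket N) :
    Instr N M → Module.End ℂ (Matrix (Work N) (Work N) ℂ)
  | .gate U => conjBy U.1
  | .consume m V => interact V.1 (ketbra (x m))

/-- The number of copies of the `m`-th data state that an instruction consumes. -/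
def Instr.copies {N M : ℕ} (m : Fin M) : Instr N M → ℕ
  | .gate _ => 0
  | .consume m' _ => if m' = m then 1 else 0

/-- The effect of a program, whose instructions are executed from left to right. -/
def run {N M : ℕ} (x : Fin M → Ket N) (p : Program N M) :
    Module.End ℂ (Matrix (Work N) (Work N) ℂ) :=
  p.foldl (fun Φ i => i.run x ∘ₗ Φ) LinearMap.id

/-- The number of copies of the `m`-th data state that a program consumes. -/
def copies {N M : ℕ} (m : Fin M) (p : Program N M) : ℕ :=
  (p.map (Instr.copies m)).sum

/-! ### Hebbian matrices -/

/-- The classical normalized Hebbian weight matrix of `M` vectors of dimension `d = 2 ^ N`. -/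
def classicalHebbian {N M : ℕ} (ξ : Fin M → Basis N → ℝ) : Matrix (Basis N) (Basis N) ℝ :=
  Matrix.of fun i j => if i = j then 0 else 1 / (M * 2 ^ N) * ∑ m, ξ m i * ξ m j

/-- The encoding `d^{-1/2} ∑ᵢ ξᵢ |i⟩` of a real vector of dimension `d = 2 ^ N`. -/
def encode {N : ℕ} (ξ : Basis N → ℝ) : Ket N :=
  WithLp.toLp 2 fun i => ((ξ i / Real.sqrt (2 ^ N) : ℝ) : ℂ)

/-- The ensemble state `ρ = (1/M) ∑ₘ |x^(m)⟩⟨x^(m)|`. -/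
def ensemble {N M : ℕ} (x : Fin M → Ket N) : Op N :=
  (1 / M : ℂ) • ∑ m, ketbra (x m)

/-- `I / d` on `N` qubits, `d = 2 ^ N`. -/
def maxMixed (N : ℕ) : Op N := (1 / 2 ^ N : ℂ) • 1

/-- The quantum analogue `W = ρ - I / d` of the Hebbian matrix. -/
def quantumHebbian {N M : ℕ} (x : Fin M → Ket N) : Op N :=
  ensemble x - maxMixed N

theorem maxMixed_isHermitian (N : ℕ) : (maxMixed N).IsHermitian := by
  rw [Matrix.IsHermitian, maxMixed, Matrix.conjTranspose_smul]
  simp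

/-- Quantum Hebbian learning for `M` training states of `N` qubits.
* `W` is a quantum analogue of the Hebbian matrix: on encoded activation patterns (entries `±1`)
  it is the classical Hebbian weight matrix.
* `prog` makes `W` operationally available: for every time `t` and every accuracy `ε`, the program
  `prog t ε`, which does not depend on the data, uses copies of the data to enact
  `e^{-i t |1⟩⟨1| ⊗ W}` on the learning and processing qubits, to error `ε` in diamond norm. -/
structure IsQHL {N M : ℕ} (W : (Fin M → Ket N) → Op N) (prog : ℝ → ℝ → Program N M) :
    Prop where
  represents : ∀ ξ : Fin M → Basis N → ℝ, (∀ m i, ξ m i = 1 ∨ ξ m i = -1) →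
    W (fun m => encode (ξ m)) = (classicalHebbian ξ).map Complex.ofReal
  available : ∀ x : Fin M → Ket N, (∀ m, ‖x m‖ = 1) → ∀ t ε : ℝ, 0 < ε →
    diamondNorm (run x (prog t ε) - conjBy (evolve (controlled (W x)) t)) ≤ ENNReal.ofReal ε

/-! ### Batched controlled quantum state exponentiation -/

/-- The controlled partial swap `e^{-i τ |1⟩⟨1| ⊗ S}` with one copy of the `m`-th data state. -/
def partialSwap (N : ℕ) {M : ℕ} (τ : ℝ) (m : Fin M) : Instr N M :=
  .consume m ⟨evolve (controlledSwap N) τ,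
    evolve_mem_unitaryGroup (controlledSwap_isHermitian N) τ⟩

/-- A batch partial swap: `M` controlled partial swaps, each for time `Δt / M`, with the data states
`x^(1), …, x^(M)` in this order. -/
def batch (N M : ℕ) (Δt : ℝ) : Program N M :=
  List.ofFn fun m : Fin M => partialSwap N (Δt / M) m

/-- bcQSE for time `t` with `n` batches. -/
def bcQSE (N M : ℕ) (t : ℝ) (n : ℕ) : Program N M :=
  (List.replicate n (batch N M (t / n))).flatten

/-- The conditional phase `e^{i Δt |1⟩⟨1| ⊗ I/d}`. -/
def conditionalPhase (N : ℕ) (Δt : ℝ) : Matrix (Work N) (Work N) ℂ :=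
  evolve (controlled (maxMixed N)) (-Δt)

/-- bcQSE for time `t` with `n` batches, each batch followed by the conditional phase. -/
def bcQSEWithPhase (N M : ℕ) (t : ℝ) (n : ℕ) : Program N M :=
  (List.replicate n (batch N M (t / n) ++
    [.gate ⟨conditionalPhase N (t / n), evolve_mem_unitaryGroup
      (controlled_isHermitian (maxMixed_isHermitian N)) _⟩])).flatten

/-- The Pauli matrix `Z`. -/
def pauliZ : Matrix (Fin 2) (Fin 2) ℂ := Matrix.diagonal ![1, -1]

end QHL

end

/-! The engine is the swap trick: tracing the data out of `S (σ ⊗ |x⟩⟨x|)` leaves `|x⟩⟨x| σ`, and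
out of `(σ ⊗ |x⟩⟨x|) S` leaves `σ |x⟩⟨x|`. A controlled partial swap therefore has the first-order
part `σ ↦ -i [|1⟩⟨1| ⊗ |x⟩⟨x|, σ]`, with a remainder of second order (`hasGenerator_partialSwap`).
Over a batch the generators average to that of `ρ`, and the remainders and cross terms sum to at
most `6 Δt²`, whatever `M` is (`bounds_run_partialSwaps`). The exact evolution has the same
first-order part and remainder at most `4 Δt²`, so a batch is wrong by at most `10 Δt²`
(`isDiamondBound_batch_sub`). All maps involved are contractions, so the errors of `n` batches add
up to `n · 10 (t/n)²` (`IsDiamondBound.pow_sub_pow`).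

Since `I/d` is scalar, `|1⟩⟨1| ⊗ I/d` commutes with every `|1⟩⟨1| ⊗ A`. The evolution under `W` thus
factors exactly into the evolution under `ρ` and the conditional phase; applying the phases adds no
error, and omitting them costs only the distance of the total phase from the identity, of order
`|t|/d`.

Diamond-norm estimates reduce to operator norms through `isDiamondBound_interact₂`: the
amplification of `σ ↦ Tr_b (V (σ ⊗ τ) Wᴴ)` has the same form, and for pure `τ` its trace-norm bound
is `‖V‖ ‖W‖`. This rests on the duality of trace norm and operator norm. -/

noncomputable section

set_option linter.unusedSectionVars false

namespace QHL

open scoped Matrix.Norms.L2Operator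

/-! ### Operator norms of isometries, unitaries and matrix entries. -/

section OperatorNorm

variable {a b : Type*} [Fintype a] [DecidableEq a] [Fintype b] [DecidableEq b]

/-- A contraction can be recognised from its Gram matrix. -/
theorem norm_le_one_of_gram {A : Matrix a b ℂ} (h : ‖A.conjTranspose * A‖ ≤ 1) : ‖A‖ ≤ 1 := by
  rw [Matrix.l2_opNorm_conjTranspose_mul_self] at h
  nlinarith [norm_nonneg A]

/-- Equality fails for an empty index type, where the identity is zero. -/
theorem norm_one_matrix_le : ‖(1 : Matrix a a ℂ)‖ ≤ 1 := by
  rw [← Matrix.diagonal_one, Matrix.l2_opNorm_diagonal]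
  exact (pi_norm_le_iff_of_nonneg zero_le_one).2 fun i => by simp

theorem norm_le_one_of_isometry {A : Matrix a b ℂ} (h : A.conjTranspose * A = 1) : ‖A‖ ≤ 1 :=
  norm_le_one_of_gram (h ▸ norm_one_matrix_le)

theorem norm_le_one_of_mem_unitaryGroup {U : Matrix a a ℂ} (h : U ∈ Matrix.unitaryGroup a ℂ) :
    ‖U‖ ≤ 1 :=
  norm_le_one_of_isometry (Matrix.mem_unitaryGroup_iff'.1 h)

theorem norm_mul_le_one {l m n : Type*} [Fintype l] [DecidableEq l] [Fintype m] [DecidableEq m]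
    [Fintype n] [DecidableEq n] {A : Matrix l m ℂ} {B : Matrix m n ℂ} (hA : ‖A‖ ≤ 1)
    (hB : ‖B‖ ≤ 1) : ‖A * B‖ ≤ 1 :=
  (Matrix.l2_opNorm_mul A B).trans (mul_le_one₀ hA (norm_nonneg _) hB)

theorem norm_entry_le (A : Matrix a b ℂ) (i : a) (j : b) : ‖A i j‖ ≤ ‖A‖ := by
  have h := Matrix.l2_opNorm_mulVec A (EuclideanSpace.single j (1 : ℂ))
  have h2 := PiLp.norm_apply_le
    ((EuclideanSpace.equiv a ℂ).symm (A.mulVec (EuclideanSpace.single j (1 : ℂ)).ofLp)) i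
  have h3 := h2.trans h
  simpa using h3

end OperatorNorm

/-! ### Singular values, and trace norm as the dual of the operator norm. -/

section TraceNorm

variable {a b : Type*} [Fintype a] [DecidableEq a] [Fintype b] [DecidableEq b]

open scoped ComplexOrder in
/-- A form of the singular value decomposition, with a partial isometry `D`. -/
theorem exists_singular_decomposition (A : Matrix a a ℂ) :
    ∃ D U : Matrix a a ℂ, ∃ s : a → ℝ, ‖D‖ ≤ 1 ∧ U * U.conjTranspose = 1 ∧
      U.conjTranspose * U = 1 ∧ (∀ i, 0 ≤ s i) ∧ traceNorm A = ∑ i, s i ∧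
      A = D * Matrix.diagonal (fun i => (s i : ℂ)) * U.conjTranspose ∧
      D.conjTranspose * D * Matrix.diagonal (fun i => (s i : ℂ)) =
        Matrix.diagonal (fun i => (s i : ℂ)) := by
  have hA := Matrix.isHermitian_conjTranspose_mul_self A
  set U : Matrix a a ℂ := hA.eigenvectorUnitary.1
  set lam := hA.eigenvalues
  have hlam0 : ∀ i, 0 ≤ lam i := fun i =>
    (Matrix.posSemidef_conjTranspose_mul_self A).eigenvalues_nonneg i
  have hU1 : U * U.conjTranspose = 1 := Matrix.mem_unitaryGroup_iff.1 hA.eigenvectorUnitary.2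
  have hU2 : U.conjTranspose * U = 1 := Matrix.mem_unitaryGroup_iff'.1 hA.eigenvectorUnitary.2
  have hdiag : (A * U).conjTranspose * (A * U) = Matrix.diagonal (fun i => (lam i : ℂ)) := by
    have := hA.conjStarAlgAut_star_eigenvectorUnitary
    rw [Unitary.conjStarAlgAut_apply] at this
    rw [Matrix.conjTranspose_mul]
    simpa [Matrix.mul_assoc, Matrix.star_eq_conjTranspose, Function.comp_def] using this
  set s : a → ℝ := fun i => Real.sqrt (lam i) with hs
  have hs2 : ∀ i, (lam i : ℂ) = s i * s i := fun i => by
    rw [← Complex.ofReal_mul, hs, Real.mul_self_sqrt (hlam0 i)]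
  -- Because `0⁻¹ = 0`, the columns of `D` at vanishing singular values are zero, which makes `D` a
  -- partial isometry without a case split in its definition.
  set D : Matrix a a ℂ := A * U * Matrix.diagonal (fun i => ((s i)⁻¹ : ℂ)) with hD
  have hgram : D.conjTranspose * D = Matrix.diagonal (fun i => if s i = 0 then (0 : ℂ) else 1) := by
    rw [hD, Matrix.conjTranspose_mul, Matrix.mul_assoc, ← Matrix.mul_assoc (A * U).conjTranspose,
      hdiag, Matrix.diagonal_conjTranspose, Matrix.diagonal_mul_diagonal,
      Matrix.diagonal_mul_diagonal]
    congr 1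
    ext i
    by_cases h : s i = 0
    · simp [h]
    · have h' : (s i : ℂ) ≠ 0 := by exact_mod_cast h
      simp only [hs2 i, h, if_false, Pi.star_apply, star_inv₀, RCLike.star_def,
        Complex.conj_ofReal]
      field_simp
  have hAU : A * U = D * Matrix.diagonal (fun i => (s i : ℂ)) := by
    ext i j
    rw [Matrix.mul_diagonal, hD, Matrix.mul_diagonal]
    by_cases h : s j = 0
    -- A diagonal Gram entry is the squared norm of a column, so a zero singular value kills the
    -- whole column of `A * U`.
    · have h0 : ((A * U).conjTranspose * (A * U)) j j = 0 := by
        rw [hdiag, Matrix.diagonal_apply_eq, hs2 j, h]; simp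
      have h1 : ∑ k, ‖(A * U) k j‖ ^ 2 = 0 := by
        rw [Matrix.mul_apply] at h0
        have : ((∑ k, ‖(A * U) k j‖ ^ 2 : ℝ) : ℂ) = 0 := by
          rw [← h0]
          push_cast
          refine Finset.sum_congr rfl fun k _ => ?_
          rw [Matrix.conjTranspose_apply, RCLike.star_def, Complex.conj_mul']
        exact_mod_cast this
      have h2 := (Finset.sum_eq_zero_iff_of_nonneg (fun k _ => by positivity)).1 h1 i
        (Finset.mem_univ i)
      have h3 : (A * U) i j = 0 := by simpa using h2
      rw [h3]; simp
    · have h' : (s j : ℂ) ≠ 0 := by exact_mod_cast h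
      field_simp
  refine ⟨D, U, s, norm_le_one_of_gram ?_, hU1, hU2, fun i => Real.sqrt_nonneg _, rfl, ?_, ?_⟩
  · rw [hgram, Matrix.l2_opNorm_diagonal]
    refine (pi_norm_le_iff_of_nonneg zero_le_one).2 fun i => ?_
    split_ifs <;> simp
  · rw [← hAU, Matrix.mul_assoc, hU1, mul_one]
  · rw [hgram, Matrix.diagonal_mul_diagonal]
    congr 1
    ext i
    split_ifs with h <;> simp [h]

theorem traceNorm_nonneg (A : Matrix a a ℂ) : 0 ≤ traceNorm A :=
  Finset.sum_nonneg fun _ _ => Real.sqrt_nonneg _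

/-- Hölder's inequality for the trace norm and the operator norm. -/
theorem norm_trace_mul_le (B A : Matrix a a ℂ) : ‖(B * A).trace‖ ≤ ‖B‖ * traceNorm A := by
  obtain ⟨D, U, s, hD, -, hU, hs, hA, hdec, -⟩ := exists_singular_decomposition A
  have hU' : ‖U.conjTranspose‖ ≤ 1 := by
    rw [Matrix.l2_opNorm_conjTranspose]; exact norm_le_one_of_isometry hU
  have h1 : (B * A).trace =
      ((U.conjTranspose * (B * D)) * Matrix.diagonal (fun i => (s i : ℂ))).trace := by
    conv_lhs => rw [hdec]
    rw [Matrix.mul_assoc U.conjTranspose, Matrix.trace_mul_comm U.conjTranspose]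
    simp only [Matrix.mul_assoc]
  have h2 : ‖U.conjTranspose * (B * D)‖ ≤ ‖B‖ := by
    refine (norm_mul_le _ _).trans ?_
    have := norm_mul_le B D
    nlinarith [norm_nonneg B, norm_nonneg D, norm_nonneg (B * D), norm_nonneg U.conjTranspose]
  rw [h1, hA, Matrix.trace, Finset.mul_sum]
  refine (norm_sum_le _ _).trans (Finset.sum_le_sum fun i _ => ?_)
  rw [Matrix.diag_apply, Matrix.mul_diagonal, norm_mul, Complex.norm_real, Real.norm_eq_abs,
    abs_of_nonneg (hs i)]
  exact mul_le_mul_of_nonneg_right ((norm_entry_le _ _ _).trans h2) (hs i)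

/-- The witness `U Dᴴ` undoes the partial isometry in `A = D s Uᴴ`: as `Dᴴ D` fixes `s`, the product
is `U s Uᴴ`, whose trace is the sum of the singular values. -/
theorem exists_trace_mul_eq_traceNorm (A : Matrix a a ℂ) :
    ∃ B : Matrix a a ℂ, ‖B‖ ≤ 1 ∧ (B * A).trace = traceNorm A := by
  obtain ⟨D, U, s, hD, -, hU, hs, hA, hdec, hs'⟩ := exists_singular_decomposition A
  refine ⟨U * D.conjTranspose, norm_mul_le_one (norm_le_one_of_isometry hU) ?_, ?_⟩
  · rwa [Matrix.l2_opNorm_conjTranspose]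
  · have : U * D.conjTranspose * A =
        U * (D.conjTranspose * D * Matrix.diagonal (fun i => (s i : ℂ)) * U.conjTranspose) := by
      conv_lhs => rw [hdec]
      simp only [Matrix.mul_assoc]
    rw [this, hs', Matrix.trace_mul_comm, Matrix.mul_assoc, hU, mul_one, Matrix.trace_diagonal, hA]
    push_cast
    rfl

/-- The trace norm is dual to the operator norm. -/
theorem traceNorm_le_of_forall_trace {A : Matrix a a ℂ} {c : ℝ}
    (h : ∀ B : Matrix a a ℂ, ‖B‖ ≤ 1 → ‖(B * A).trace‖ ≤ c) : traceNorm A ≤ c := by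
  obtain ⟨B, hB, hBA⟩ := exists_trace_mul_eq_traceNorm A
  have := h B hB
  rwa [hBA, Complex.norm_real, Real.norm_eq_abs, abs_of_nonneg (traceNorm_nonneg A)] at this

theorem norm_trace_mul_le_traceNorm {A B : Matrix a a ℂ} (hB : ‖B‖ ≤ 1) :
    ‖(B * A).trace‖ ≤ traceNorm A :=
  (norm_trace_mul_le B A).trans (mul_le_of_le_one_left (traceNorm_nonneg A) hB)

theorem traceNorm_add_le (A B : Matrix a a ℂ) :
    traceNorm (A + B) ≤ traceNorm A + traceNorm B :=
  traceNorm_le_of_forall_trace fun X hX => by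
    rw [mul_add, Matrix.trace_add]
    exact (norm_add_le _ _).trans
      (add_le_add (norm_trace_mul_le_traceNorm hX) (norm_trace_mul_le_traceNorm hX))

theorem traceNorm_smul_le (c : ℂ) (A : Matrix a a ℂ) : traceNorm (c • A) ≤ ‖c‖ * traceNorm A :=
  traceNorm_le_of_forall_trace fun X hX => by
    rw [Matrix.mul_smul, Matrix.trace_smul, norm_smul]
    exact mul_le_mul_of_nonneg_left (norm_trace_mul_le_traceNorm hX) (norm_nonneg c)

/-- By duality and cyclicity of the trace, the outer factors can be moved onto the test operator.
Rectangular factors are allowed so that isometries into a larger space are covered. -/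
theorem traceNorm_mul_mul_le {A : Matrix b a ℂ} {X : Matrix a a ℂ} {B : Matrix a b ℂ} :
    traceNorm (A * X * B) ≤ ‖A‖ * ‖B‖ * traceNorm X :=
  traceNorm_le_of_forall_trace fun Y hY => by
    have h : (Y * (A * X * B)).trace = (B * Y * A * X).trace := by
      rw [← Matrix.mul_assoc, Matrix.trace_mul_comm]
      simp only [Matrix.mul_assoc]
    rw [h]
    refine (norm_trace_mul_le _ _).trans
      (mul_le_mul_of_nonneg_right ?_ (traceNorm_nonneg X))
    have h1 := Matrix.l2_opNorm_mul (B * Y) A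
    have h2 := Matrix.l2_opNorm_mul B Y
    have h3 := mul_le_of_le_one_right (norm_nonneg B) hY
    nlinarith [norm_nonneg A]

end TraceNorm

/-! ### Tensor products, relabelling, partial trace and adjoined pure states. -/

section Amplification

variable {a b c : Type*} [Fintype a] [DecidableEq a] [Fintype b] [DecidableEq b]
  [Fintype c] [DecidableEq c]

/-- Tensoring with a projection and relabelling, as a homomorphism of C⋆-algebras. -/
def kroneckerProjection (P : Matrix b b ℂ) (hP : P * P = P) (hP' : P.conjTranspose = P)
    (e : c ≃ a × b) : Matrix a a ℂ →⋆ₙₐ[ℂ] Matrix c c ℂ where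
  toFun A := (A ⊗ₖ P).submatrix e e
  map_smul' r A := by rw [Matrix.smul_kronecker]; rfl
  map_zero' := by rw [Matrix.zero_kronecker]; rfl
  map_add' A B := by rw [Matrix.add_kronecker]; rfl
  map_mul' A B := by
    rw [Matrix.submatrix_mul_equiv, ← Matrix.mul_kronecker_mul, hP]
  map_star' A := by
    rw [Matrix.star_eq_conjTranspose, Matrix.star_eq_conjTranspose,
      Matrix.conjTranspose_submatrix, Matrix.conjTranspose_kronecker, hP']

/-- Homomorphisms of C⋆-algebras are contractive. Taking `P = 1` gives amplification, `P = |1⟩⟨1|`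
gives control by a qubit, and a one-point second factor gives relabelling of the basis. -/
theorem norm_kronecker_projection_le (A : Matrix a a ℂ) {P : Matrix b b ℂ} (hP : P * P = P)
    (hP' : P.conjTranspose = P) (e : c ≃ a × b) : ‖(A ⊗ₖ P).submatrix e e‖ ≤ ‖A‖ :=
  NonUnitalStarAlgHom.norm_apply_le (kroneckerProjection P hP hP' e) A

theorem norm_kronecker_one_le (A : Matrix a a ℂ) : ‖A ⊗ₖ (1 : Matrix b b ℂ)‖ ≤ ‖A‖ :=
  norm_kronecker_projection_le A (mul_one 1) (by simp) (Equiv.refl (a × b))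

theorem norm_submatrix_equiv_le (A : Matrix a a ℂ) (e : c ≃ a) : ‖A.submatrix e e‖ ≤ ‖A‖ := by
  have := norm_kronecker_projection_le A (P := (1 : Matrix Unit Unit ℂ)) (mul_one 1) (by simp)
    (e.trans (Equiv.prodPUnit a).symm)
  have h : (A ⊗ₖ (1 : Matrix Unit Unit ℂ)).submatrix (e.trans (Equiv.prodPUnit a).symm)
      (e.trans (Equiv.prodPUnit a).symm) = A.submatrix e e := by
    ext i j
    simp
  rwa [h] at this

theorem norm_controlled_le (A : Matrix a a ℂ) : ‖controlled A‖ ≤ ‖A‖ := by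
  have := norm_kronecker_projection_le A (P := (Matrix.single 1 1 1 : Matrix (Fin 2) (Fin 2) ℂ))
    (by simp) (by simp) (Equiv.prodComm (Fin 2) a)
  have h : (A ⊗ₖ (Matrix.single 1 1 1 : Matrix (Fin 2) (Fin 2) ℂ)).submatrix
      (Equiv.prodComm (Fin 2) a) (Equiv.prodComm (Fin 2) a) = controlled A := by
    ext i j
    simp [controlled, mul_comm]
  rwa [h] at this

/-- The partial trace is a contraction for the trace norm. -/
theorem traceNorm_traceRight_le (A : Matrix (a × b) (a × b) ℂ) :
    traceNorm (traceRight A) ≤ traceNorm A :=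
  traceNorm_le_of_forall_trace fun B hB => by
    -- The partial trace is adjoint to `B ↦ B ⊗ 1`, which does not increase the operator norm.
    have h : (B * traceRight A).trace = ((B ⊗ₖ (1 : Matrix b b ℂ)) * A).trace := by
      simp only [Matrix.trace, Matrix.diag_apply, Matrix.mul_apply, traceRight, Matrix.of_apply,
        Matrix.kronecker_apply, Fintype.sum_prod_type, Matrix.one_apply, mul_ite, mul_one,
        mul_zero, ite_mul, zero_mul, Finset.sum_ite_eq, Finset.mem_univ, if_true, Finset.mul_sum]
      exact Finset.sum_congr rfl fun i _ => Finset.sum_comm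
    rw [h]
    exact norm_trace_mul_le_traceNorm ((norm_kronecker_one_le B).trans hB)

/-- The isometry `v ↦ v ⊗ ψ`. -/
def adjoin (a : Type*) [DecidableEq a] (ψ : b → ℂ) : Matrix (a × b) a ℂ :=
  Matrix.of fun p j => if p.1 = j then ψ p.2 else 0

theorem adjoin_isometry {ψ : b → ℂ} (hψ : ∑ q, star (ψ q) * ψ q = 1) :
    (adjoin a ψ).conjTranspose * adjoin a ψ = 1 := by
  ext i j
  simp only [adjoin, Matrix.mul_apply, Matrix.conjTranspose_apply, Matrix.of_apply,
    Fintype.sum_prod_type, apply_ite star, star_zero, mul_ite, mul_zero, ite_mul, zero_mul,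
    Matrix.one_apply]
  rw [Finset.sum_eq_single j]
  · by_cases h : j = i
    · simp only [h, if_true, hψ]
    · simp [h, Ne.symm h]
  · intro x _ hx
    simp [hx]
  · simp

theorem kronecker_eq_adjoin (X : Matrix a a ℂ) (ψ : b → ℂ) :
    X ⊗ₖ Matrix.vecMulVec ψ (star ψ) = adjoin a ψ * X * (adjoin a ψ).conjTranspose := by
  ext ⟨i, q⟩ ⟨j, r⟩
  simp only [adjoin, Matrix.mul_apply, Matrix.conjTranspose_apply, Matrix.of_apply,
    apply_ite star, star_zero, mul_ite, mul_zero, ite_mul, zero_mul, Matrix.kronecker_apply,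
    Matrix.vecMulVec_apply, Finset.sum_ite_eq, Finset.mem_univ, if_true, Pi.star_apply]
  ring

/-- Adjoining a pure state is conjugation by the isometry `v ↦ v ⊗ ψ`. -/
theorem traceNorm_kronecker_pure_le (X : Matrix a a ℂ) {ψ : b → ℂ}
    (hψ : ∑ q, star (ψ q) * ψ q = 1) :
    traceNorm (X ⊗ₖ Matrix.vecMulVec ψ (star ψ)) ≤ traceNorm X := by
  rw [kronecker_eq_adjoin]
  refine traceNorm_mul_mul_le.trans (mul_le_of_le_one_left (traceNorm_nonneg X) ?_)
  rw [Matrix.l2_opNorm_conjTranspose]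
  have := norm_le_one_of_isometry (adjoin_isometry (a := a) hψ)
  exact mul_le_one₀ this (norm_nonneg _) this

end Amplification

/-! ### Bounds uniform in the ancilla, and channels with an adjoined system. -/

section CompletelyBounded

variable {a b : Type*} [Fintype a] [DecidableEq a] [Fintype b] [DecidableEq b]

/-- `c` bounds all the amplifications of `Φ` in trace norm. -/
def IsDiamondBound (Φ : Module.End ℂ (Matrix a a ℂ)) (c : ℝ) : Prop :=
  ∀ (k : ℕ) (X : Matrix (a × Fin k) (a × Fin k) ℂ),
    traceNorm (ampliate Φ k X) ≤ c * traceNorm X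

namespace IsDiamondBound

variable {Φ Ψ : Module.End ℂ (Matrix a a ℂ)} {c d : ℝ}

theorem diamondNorm_le (h : IsDiamondBound Φ c) : diamondNorm Φ ≤ ENNReal.ofReal c := by
  refine iSup_le fun k => iSup_le fun X => iSup_le fun hX => ?_
  rcases le_or_gt 0 c with hc | hc
  · exact ENNReal.ofReal_le_ofReal ((h k X).trans (mul_le_of_le_one_right hc hX))
  · rw [ENNReal.ofReal_of_nonpos ((h k X).trans
      (mul_nonpos_of_nonpos_of_nonneg hc.le (traceNorm_nonneg X)))]
    exact zero_le

theorem mono (h : IsDiamondBound Φ c) (hcd : c ≤ d) : IsDiamondBound Φ d := fun k X =>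
  (h k X).trans (mul_le_mul_of_nonneg_right hcd (traceNorm_nonneg X))

theorem add (h : IsDiamondBound Φ c) (h' : IsDiamondBound Ψ d) :
    IsDiamondBound (Φ + Ψ) (c + d) := fun k X => by
  have : ampliate (Φ + Ψ) k X = ampliate Φ k X + ampliate Ψ k X := rfl
  rw [this, add_mul]
  exact (traceNorm_add_le _ _).trans (add_le_add (h k X) (h' k X))

theorem smul (h : IsDiamondBound Φ c) (z : ℂ) : IsDiamondBound (z • Φ) (‖z‖ * c) := fun k X => by
  have : ampliate (z • Φ) k X = z • ampliate Φ k X := rfl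
  rw [this, mul_assoc]
  exact (traceNorm_smul_le _ _).trans (mul_le_mul_of_nonneg_left (h k X) (norm_nonneg z))

theorem neg (h : IsDiamondBound Φ c) : IsDiamondBound (-Φ) c := by
  have := h.smul (-1)
  have h' : (-1 : ℂ) • Φ = -Φ := by
    ext
    simp
  rwa [h', norm_neg, norm_one, one_mul] at this

theorem sub (h : IsDiamondBound Φ c) (h' : IsDiamondBound Ψ d) :
    IsDiamondBound (Φ - Ψ) (c + d) := by
  rw [sub_eq_add_neg]
  exact h.add h'.neg

theorem comp (h : IsDiamondBound Φ c) (h' : IsDiamondBound Ψ d) (hc : 0 ≤ c) :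
    IsDiamondBound (Φ * Ψ) (c * d) := fun k X => by
  have : ampliate (Φ * Ψ) k X = ampliate Φ k (ampliate Ψ k X) := rfl
  rw [this, mul_assoc]
  exact (h k _).trans (mul_le_mul_of_nonneg_left (h' k X) hc)

theorem one : IsDiamondBound (1 : Module.End ℂ (Matrix a a ℂ)) 1 := fun k X => by
  have : ampliate (1 : Module.End ℂ (Matrix a a ℂ)) k X = X := rfl
  rw [this, one_mul]

theorem zero : IsDiamondBound (0 : Module.End ℂ (Matrix a a ℂ)) 0 := by
  simpa using (one (a := a)).smul 0

end IsDiamondBound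

/-- The map `σ ↦ Tr_b (V (σ ⊗ τ) Wᴴ)`, the polarization of `interact`. -/
def interact₂ (τ : Matrix b b ℂ) (V W : Matrix (a × b) (a × b) ℂ) :
    Module.End ℂ (Matrix a a ℂ) where
  toFun σ := traceRight (V * (σ ⊗ₖ τ) * W.conjTranspose)
  map_add' X Y := by
    rw [Matrix.add_kronecker, mul_add, add_mul]
    ext i j
    simp [traceRight, Finset.sum_add_distrib]
  map_smul' c X := by
    rw [Matrix.smul_kronecker, Matrix.mul_smul, Matrix.smul_mul]
    ext i j
    simp [traceRight, Finset.mul_sum]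

theorem interact_eq_interact₂ (V : Matrix (a × b) (a × b) ℂ) (τ : Matrix b b ℂ) :
    interact V τ = interact₂ τ V V := rfl

theorem interact₂_add_left (τ : Matrix b b ℂ) (V V' W : Matrix (a × b) (a × b) ℂ) :
    interact₂ τ (V + V') W = interact₂ τ V W + interact₂ τ V' W := by
  ext σ i j
  simp [interact₂, traceRight, add_mul, Finset.sum_add_distrib]

theorem interact₂_add_right (τ : Matrix b b ℂ) (V W W' : Matrix (a × b) (a × b) ℂ) :
    interact₂ τ V (W + W') = interact₂ τ V W + interact₂ τ V W' := by
  ext σ i j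
  simp [interact₂, traceRight, mul_add, Finset.sum_add_distrib]

theorem interact₂_smul_left (τ : Matrix b b ℂ) (z : ℂ) (V W : Matrix (a × b) (a × b) ℂ) :
    interact₂ τ (z • V) W = z • interact₂ τ V W := by
  ext σ i j
  simp [interact₂, traceRight, Finset.mul_sum]

theorem interact₂_smul_right (τ : Matrix b b ℂ) (z : ℂ) (V W : Matrix (a × b) (a × b) ℂ) :
    interact₂ τ V (z • W) = star z • interact₂ τ V W := by
  ext σ i j
  simp [interact₂, traceRight, Finset.mul_sum]

/-- The ancilla and the adjoined system, interchanged. -/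
def ancillaComm (a b c : Type*) : (a × c) × b ≃ (a × b) × c where
  toFun p := ((p.1.1, p.2), p.1.2)
  invFun p := ((p.1.1, p.2), p.1.2)

/-- The ancilla is absorbed into the system, so estimates for all amplifications follow from the
unamplified form. -/
theorem ampliate_interact₂ (τ : Matrix b b ℂ) (V W : Matrix (a × b) (a × b) ℂ) (k : ℕ)
    (X : Matrix (a × Fin k) (a × Fin k) ℂ) :
    ampliate (interact₂ τ V W) k X = interact₂ τ
      ((V ⊗ₖ (1 : Matrix (Fin k) (Fin k) ℂ)).submatrix (ancillaComm _ _ _) (ancillaComm _ _ _))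
      ((W ⊗ₖ (1 : Matrix (Fin k) (Fin k) ℂ)).submatrix (ancillaComm _ _ _) (ancillaComm _ _ _))
      X := by
  ext ⟨i, p⟩ ⟨j, r⟩
  simp only [ampliate, interact₂, traceRight, Matrix.of_apply, LinearMap.coe_mk, AddHom.coe_mk,
    Matrix.mul_apply, Matrix.kronecker_apply, Matrix.conjTranspose_apply, Matrix.submatrix_apply,
    ancillaComm, Equiv.coe_fn_mk, Fintype.sum_prod_type, Matrix.one_apply, mul_ite, mul_one,
    mul_zero, ite_mul, zero_mul, apply_ite star, star_zero, Finset.sum_ite_irrel,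
    Finset.sum_const_zero, Finset.sum_ite_eq, Finset.mem_univ, if_true]

theorem isDiamondBound_interact₂ {ψ : b → ℂ} (hψ : ∑ q, star (ψ q) * ψ q = 1)
    (V W : Matrix (a × b) (a × b) ℂ) :
    IsDiamondBound (interact₂ (Matrix.vecMulVec ψ (star ψ)) V W) (‖V‖ * ‖W‖) := fun k X => by
  rw [ampliate_interact₂]
  refine (traceNorm_traceRight_le _).trans (traceNorm_mul_mul_le.trans ?_)
  rw [Matrix.l2_opNorm_conjTranspose]
  have h : ∀ V : Matrix (a × b) (a × b) ℂ, ‖(V ⊗ₖ (1 : Matrix (Fin k) (Fin k) ℂ)).submatrix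
      (ancillaComm a b (Fin k)) (ancillaComm a b (Fin k))‖ ≤ ‖V‖ := fun V =>
    norm_kronecker_projection_le V (mul_one 1) (by simp) _
  exact mul_le_mul (mul_le_mul (h V) (h W) (norm_nonneg _) (norm_nonneg _))
    (traceNorm_kronecker_pure_le X hψ) (traceNorm_nonneg _)
    (mul_nonneg (norm_nonneg _) (norm_nonneg _))

end CompletelyBounded

/-! ### Taylor estimates and algebra of matrix exponentials. -/

section Exponential

/-- Second-order Taylor estimate for the exponential in a Banach algebra. -/
theorem norm_exp_sub_one_sub_id_le {A : Type*} [NormedRing A] [NormedAlgebra ℂ A]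
    [CompleteSpace A] {x : A} (hx : ‖x‖ ≤ 1) : ‖NormedSpace.exp x - 1 - x‖ ≤ ‖x‖ ^ 2 := by
  have h1 := (hasSum_nat_add_iff' 2).2 (NormedSpace.exp_series_hasSum_exp' (𝕂 := ℂ) x)
  have h2 := (hasSum_nat_add_iff' 2).2 (NormedSpace.exp_series_hasSum_exp' (𝕂 := ℝ) ‖x‖)
  rw [← Real.exp_eq_exp_ℝ] at h2
  simp only [Finset.sum_range_succ, Finset.sum_range_zero, Nat.factorial, pow_zero, pow_one,
    Nat.cast_one, inv_one, one_smul, zero_add, mul_one, ← sub_sub, smul_eq_mul, one_mul] at h1 h2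
  have h3 : ‖NormedSpace.exp x - 1 - x‖ ≤ Real.exp ‖x‖ - 1 - ‖x‖ := by
    rw [← h1.tsum_eq]
    refine tsum_of_norm_bounded h2 fun n => ?_
    rw [norm_smul, norm_inv, Complex.norm_natCast]
    -- The power bound needs a positive exponent, since `‖1‖` may exceed `1` here; the tail starts
    -- at exponent `2`.
    exact mul_le_mul_of_nonneg_left (norm_pow_le' x (by omega)) (by positivity)
  have h4 := Real.norm_exp_sub_one_sub_id_le (x := ‖x‖) (by simpa using hx)
  rw [norm_norm] at h4
  exact h3.trans ((le_abs_self _).trans h4)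

variable {a : Type*} [Fintype a] [DecidableEq a]

theorem norm_evolve_sub_le {H : Matrix a a ℂ} (hH : ‖H‖ ≤ 1) {t : ℝ} (ht : |t| ≤ 1) :
    ‖evolve H t - 1 - (-(Complex.I * t)) • H‖ ≤ t ^ 2 := by
  have h : ‖(-(Complex.I * t)) • H‖ ≤ |t| := by
    rw [norm_smul]
    simpa using mul_le_of_le_one_right (abs_nonneg t) hH
  refine (norm_exp_sub_one_sub_id_le (h.trans ht)).trans ?_
  rw [← sq_abs t]
  exact pow_le_pow_left₀ (norm_nonneg _) h 2

theorem norm_evolve_le {H : Matrix a a ℂ} (hH : H.IsHermitian) (t : ℝ) : ‖evolve H t‖ ≤ 1 :=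
  norm_le_one_of_mem_unitaryGroup (evolve_mem_unitaryGroup hH t)

theorem evolve_pow (H : Matrix a a ℂ) (t : ℝ) (n : ℕ) : evolve H t ^ n = evolve H (n * t) := by
  rw [evolve, evolve, ← Matrix.exp_nsmul, ← Nat.cast_smul_eq_nsmul ℂ, smul_smul]
  congr 2
  push_cast
  ring

theorem evolve_sub_of_commute {H K : Matrix a a ℂ} (h : Commute H K) (t : ℝ) :
    evolve (H - K) t = evolve H t * evolve K (-t) := by
  rw [evolve, evolve, evolve, ← Matrix.exp_add_of_commute]
  · congr 1
    push_cast
    rw [mul_neg, neg_neg, smul_sub, neg_smul, neg_smul, sub_neg_eq_add, neg_add_eq_sub]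
  · exact (h.smul_left _).smul_right _

end Exponential

/-! ### First-order expansions of channels. -/

section Generator

variable {a b : Type*} [Fintype a] [DecidableEq a] [Fintype b] [DecidableEq b]

/-- The generator `σ ↦ -i [H, σ]` of the time evolution. -/
def generator (H : Matrix a a ℂ) : Module.End ℂ (Matrix a a ℂ) :=
  (-Complex.I) • (LinearMap.mulLeft ℂ H - LinearMap.mulRight ℂ H)

/-- The maps `Φ t` are contractions, and agree with `1 + t L` up to second order in `t`. -/
structure HasGenerator (Φ : ℝ → Module.End ℂ (Matrix a a ℂ)) (L : Module.End ℂ (Matrix a a ℂ)) :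
    Prop where
  bound_one : ∀ t, IsDiamondBound (Φ t) 1
  bound_generator : IsDiamondBound L 2
  bound_remainder : ∀ t, IsDiamondBound (Φ t - 1 - (t : ℂ) • L) (4 * t ^ 2)

/-- For `|t| ≤ 1` the constant is `4 + 2`, from the remainder and the generator; for larger `|t|`
the trivial bound `2` for a difference of contractions suffices. -/
theorem HasGenerator.bound_sub_one {Φ : ℝ → Module.End ℂ (Matrix a a ℂ)}
    {L : Module.End ℂ (Matrix a a ℂ)} (h : HasGenerator Φ L) (t : ℝ) :
    IsDiamondBound (Φ t - 1) (6 * |t|) := by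
  rcases le_total |t| 1 with ht | ht
  · have h1 := (h.bound_remainder t).add (h.bound_generator.smul (t : ℂ))
    rw [sub_add_cancel, Complex.norm_real, Real.norm_eq_abs] at h1
    refine h1.mono ?_
    rw [← sq_abs]
    nlinarith [abs_nonneg t]
  · exact ((h.bound_one t).sub .one).mono (by linarith)

theorem interact₂_one_one {τ : Matrix b b ℂ} (hτ : τ.trace = 1) :
    interact₂ τ (1 : Matrix (a × b) (a × b) ℂ) 1 = 1 := by
  ext σ i j
  simp only [Matrix.trace, Matrix.diag_apply] at hτ
  simp [interact₂, traceRight, ← Finset.mul_sum, hτ]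

/-- An interaction that is first-order in time on the dilated space is so on the system. -/
theorem hasGenerator_interact {ψ : b → ℂ} (hψ : ∑ q, star (ψ q) * ψ q = 1)
    {K : Matrix (a × b) (a × b) ℂ} {H : Matrix a a ℂ} (hK : ‖K‖ ≤ 1)
    (hl : interact₂ (Matrix.vecMulVec ψ (star ψ)) K 1 = LinearMap.mulLeft ℂ H)
    (hr : interact₂ (Matrix.vecMulVec ψ (star ψ)) 1 K = LinearMap.mulRight ℂ H)
    {V : ℝ → Matrix (a × b) (a × b) ℂ} (hV : ∀ t, ‖V t‖ ≤ 1)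
    (hVK : ∀ t, |t| ≤ 1 → ‖V t - 1 - (-(Complex.I * t)) • K‖ ≤ t ^ 2) :
    HasGenerator (fun t => interact (V t) (Matrix.vecMulVec ψ (star ψ))) (generator H) := by
  set τ := Matrix.vecMulVec ψ (star ψ)
  have hτ : τ.trace = 1 := by
    rw [← hψ]
    exact Finset.sum_congr rfl fun q _ => mul_comm _ _
  have hbound := isDiamondBound_interact₂ (a := a) hψ
  have hL : IsDiamondBound (generator H) 2 := by
    rw [generator, ← hl, ← hr]
    refine (((hbound K 1).sub (hbound 1 K)).smul _).mono ?_
    rw [norm_neg, Complex.norm_I]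
    have := mul_le_one₀ hK (norm_nonneg _) (norm_one_matrix_le (a := a × b))
    linarith [mul_comm ‖(1 : Matrix (a × b) (a × b) ℂ)‖ ‖K‖]
  have h1 : ∀ t, IsDiamondBound (interact (V t) τ) 1 := fun t =>
    (hbound (V t) (V t)).mono (mul_le_one₀ (hV t) (norm_nonneg _) (hV t))
  refine ⟨h1, hL, fun t => ?_⟩
  rcases le_total |t| 1 with ht | ht
  · set z : ℂ := -(Complex.I * t) with hz
    have hznorm : ‖z‖ = |t| := by simp [hz]
    -- This sign turns the two first-order terms into a commutator, as `interact₂` is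
    -- conjugate-linear in its second operator.
    have hzz : star z = -z := by simp [hz]
    set R := V t - 1 - z • K with hR
    have hVt : V t = 1 + z • K + R := by rw [hR]; abel
    have hRn : ‖R‖ ≤ t ^ 2 := hVK t ht
    have hzK : ‖z • K‖ ≤ |t| := by
      rw [norm_smul, hznorm]
      exact mul_le_of_le_one_right (abs_nonneg t) hK
    have hVR : ‖1 + z • K‖ ≤ 2 := by
      refine (norm_add_le _ _).trans ?_
      have := norm_one_matrix_le (a := a × b)
      linarith
    -- With `V t = 1 + z K + R`, only these terms survive the cancellation of orders zero and one.
    -- They are bounded by `t²`, `t²` and `2 t²`, whence the constant `4`.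
    have hdec : interact (V t) τ - 1 - (t : ℂ) • generator H =
        interact₂ τ (z • K) (z • K) + interact₂ τ R (V t) + interact₂ τ (1 + z • K) R := by
      have e1 : interact (V t) τ = interact₂ τ (1 + z • K) (1 + z • K) + interact₂ τ R (V t) +
          interact₂ τ (1 + z • K) R := by
        have e2 : interact₂ τ (V t) (V t) =
            interact₂ τ (1 + z • K) (V t) + interact₂ τ R (V t) := by
          rw [← interact₂_add_left, ← hVt]
        have e3 : interact₂ τ (1 + z • K) (V t) =
            interact₂ τ (1 + z • K) (1 + z • K) + interact₂ τ (1 + z • K) R := by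
          rw [← interact₂_add_right, ← hVt]
        rw [interact_eq_interact₂, e2, e3]
        abel
      have e4 : (t : ℂ) • generator H = z • (LinearMap.mulLeft ℂ H - LinearMap.mulRight ℂ H) := by
        rw [generator, smul_smul, hz]
        congr 1
        ring
      rw [e1, e4, interact₂_add_left τ 1 (z • K), interact₂_add_right τ 1 1,
        interact₂_add_right τ (z • K) 1, interact₂_smul_left τ z K 1,
        interact₂_smul_right τ z 1 K, interact₂_one_one hτ, hl, hr, hzz]
      module
    rw [hdec]
    refine (((hbound _ _).add (hbound _ _)).add (hbound _ _)).mono ?_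
    have b1 : ‖z • K‖ * ‖z • K‖ ≤ t ^ 2 := by
      rw [← sq_abs t, sq]
      exact mul_le_mul hzK hzK (norm_nonneg _) (abs_nonneg t)
    have b2 : ‖R‖ * ‖V t‖ ≤ t ^ 2 * 1 := mul_le_mul hRn (hV t) (norm_nonneg _) (sq_nonneg t)
    have b3 : ‖1 + z • K‖ * ‖R‖ ≤ 2 * t ^ 2 := mul_le_mul hVR hRn (norm_nonneg _) zero_le_two
    linarith
  -- For `|t| ≥ 1` no expansion is needed: `1 + 1 + 2 |t| ≤ 4 t²`.
  · refine (((h1 t).sub .one).sub (hL.smul (t : ℂ))).mono ?_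
    rw [Complex.norm_real, Real.norm_eq_abs, ← sq_abs]
    nlinarith

/-- With a one-point `b`, this lets the estimates for interactions serve for unitary conjugations
too. -/
theorem conjBy_eq_interact (U : Matrix a a ℂ) {τ : Matrix b b ℂ} (hτ : τ.trace = 1) :
    conjBy U = interact (U ⊗ₖ (1 : Matrix b b ℂ)) τ := by
  have h : ∀ σ : Matrix a a ℂ, traceRight (σ ⊗ₖ τ) = σ := fun σ => by
    ext i j
    simp only [Matrix.trace, Matrix.diag_apply] at hτ
    simp [traceRight, ← Finset.mul_sum, hτ]
  ext1 σ
  change U * σ * U.conjTranspose = traceRight _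
  rw [Matrix.conjTranspose_kronecker, Matrix.conjTranspose_one, ← Matrix.mul_kronecker_mul,
    ← Matrix.mul_kronecker_mul, one_mul, mul_one, h]

theorem hasGenerator_conjBy_evolve {H : Matrix a a ℂ} (hH : H.IsHermitian) (hH1 : ‖H‖ ≤ 1) :
    HasGenerator (fun t => conjBy (evolve H t)) (generator H) := by
  have hτ : (Matrix.vecMulVec (1 : Unit → ℂ) (star 1)).trace = 1 := by simp [Matrix.trace]
  have key := hasGenerator_interact (a := a) (b := Unit) (ψ := 1)
    (K := H ⊗ₖ (1 : Matrix Unit Unit ℂ)) (H := H) (V := fun t => evolve H t ⊗ₖ 1) (by simp)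
    ((norm_kronecker_one_le H).trans hH1) ?_ ?_
    (fun t => (norm_kronecker_one_le _).trans (norm_evolve_le hH t)) fun t ht => ?_
  · simpa only [← conjBy_eq_interact _ hτ] using key
  · ext σ i j
    simp [interact₂, traceRight, ← Matrix.mul_kronecker_mul]
  · ext σ i j
    simp [interact₂, traceRight, Matrix.conjTranspose_kronecker, ← Matrix.mul_kronecker_mul, hH.eq]
  · refine le_trans (le_of_eq_of_le ?_ (norm_kronecker_one_le (b := Unit)
      (evolve H t - 1 - (-(Complex.I * t)) • H))) (norm_evolve_sub_le hH1 ht)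
    congr 1
    ext i j
    simp [Matrix.one_apply, Prod.ext_iff]

end Generator

/-! ### Training states, their ensemble, and the swap trick. -/

section Data

variable {N M : ℕ}

theorem sum_star_mul_self {ψ : Ket N} (hψ : ‖ψ‖ = 1) : ∑ q, star (ψ q) * ψ q = 1 := by
  have h := EuclideanSpace.norm_sq_eq ψ
  rw [hψ, one_pow] at h
  have h' : ((∑ q, ‖ψ q‖ ^ 2 : ℝ) : ℂ) = 1 := by rw [← h]; simp
  rw [← h']
  push_cast
  exact Finset.sum_congr rfl fun q _ => Complex.conj_mul' _

theorem ketbra_isHermitian (ψ : Ket N) : (ketbra ψ).IsHermitian := by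
  ext i j
  simp [ketbra, mul_comm]

theorem norm_ketbra_le {ψ : Ket N} (hψ : ‖ψ‖ = 1) : ‖ketbra ψ‖ ≤ 1 := by
  have h : (ketbra ψ).conjTranspose * ketbra ψ = ketbra ψ := by
    rw [(ketbra_isHermitian ψ).eq]
    ext i j
    simp only [Matrix.mul_apply, ketbra, Matrix.of_apply]
    have : ∀ k, ψ i * star (ψ k) * (ψ k * star (ψ j)) =
        ψ i * star (ψ j) * (star (ψ k) * ψ k) := fun k => by ring
    rw [Finset.sum_congr rfl fun k _ => this k, ← Finset.mul_sum, sum_star_mul_self hψ, mul_one]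
  have h2 := Matrix.l2_opNorm_conjTranspose_mul_self (ketbra ψ)
  rw [h] at h2
  nlinarith [norm_nonneg (ketbra ψ)]

theorem ensemble_isHermitian (x : Fin M → Ket N) : (ensemble x).IsHermitian := by
  rw [Matrix.IsHermitian, ensemble, Matrix.conjTranspose_smul, Matrix.conjTranspose_sum]
  simp [(ketbra_isHermitian _).eq]

theorem norm_ensemble_le {x : Fin M → Ket N} (hx : ∀ m, ‖x m‖ = 1) : ‖ensemble x‖ ≤ 1 := by
  have h : ‖∑ m, ketbra (x m)‖ ≤ M := by
    refine (norm_sum_le _ _).trans ((Finset.sum_le_sum fun m _ => norm_ketbra_le (hx m)).trans ?_)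
    simp
  rw [ensemble, norm_smul, norm_div, norm_one, Complex.norm_natCast, one_div_mul_eq_div]
  exact div_le_one_of_le₀ h (Nat.cast_nonneg M)

theorem norm_controlledSwap_le (N : ℕ) : ‖controlledSwap N‖ ≤ 1 := by
  refine (norm_submatrix_equiv_le (controlled (swap N)) (Equiv.prodAssoc _ _ _)).trans
    ((norm_controlled_le _).trans (norm_le_one_of_isometry ?_))
  ext ⟨i, j⟩ ⟨k, l⟩
  simp only [swap, Matrix.mul_apply, Matrix.conjTranspose_apply, Matrix.of_apply, apply_ite star,
    star_one, star_zero, Matrix.one_apply, Fintype.sum_prod_type, Prod.mk.injEq, ite_and,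
    mul_ite, mul_one, mul_zero, Finset.sum_ite_eq', Finset.sum_ite_irrel, Finset.sum_const_zero, Finset.mem_univ, if_true]
  split_ifs <;> simp_all

theorem controlledSwap_apply (i k : Fin 2) (p q r s : Basis N) :
    controlledSwap N ((i, p), q) ((k, r), s) =
      if p = s then if q = r then (Matrix.single 1 1 1 : Matrix (Fin 2) (Fin 2) ℂ) i k else 0
        else 0 := by
  simp [controlledSwap, controlled, swap, ite_and]

/-- The swap trick: partially tracing a swap against a state leaves multiplication by that state;
the control qubit is a spectator. -/
theorem interact₂_controlledSwap_left (ψ : Ket N) :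
    interact₂ (ketbra ψ) (controlledSwap N) 1 = LinearMap.mulLeft ℂ (controlled (ketbra ψ)) := by
  refine LinearMap.ext fun σ => Matrix.ext fun ⟨i, p⟩ ⟨j, r⟩ => ?_
  simp only [interact₂, LinearMap.coe_mk, AddHom.coe_mk, Matrix.conjTranspose_one, mul_one]
  simp only [traceRight, Matrix.of_apply, Matrix.mul_apply, Fintype.sum_prod_type, controlledSwap_apply,
    Matrix.kronecker_apply, ite_mul, zero_mul, Finset.sum_ite_eq, Finset.mem_univ, if_true, LinearMap.mulLeft_apply, controlled]
  rw [Finset.sum_comm]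
  exact Finset.sum_congr rfl fun k _ => Finset.sum_congr rfl fun q _ => by ring

theorem interact₂_controlledSwap_right (ψ : Ket N) :
    interact₂ (ketbra ψ) 1 (controlledSwap N) = LinearMap.mulRight ℂ (controlled (ketbra ψ)) := by
  refine LinearMap.ext fun σ => Matrix.ext fun ⟨i, p⟩ ⟨j, r⟩ => ?_
  simp only [interact₂, LinearMap.coe_mk, AddHom.coe_mk, (controlledSwap_isHermitian N).eq, one_mul]
  simp only [traceRight, Matrix.of_apply, Matrix.mul_apply, Fintype.sum_prod_type, controlledSwap_apply,
    Matrix.kronecker_apply, mul_ite, mul_zero, Finset.sum_ite_eq',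
    Finset.sum_ite_irrel,
    Finset.sum_const_zero, Finset.mem_univ, if_true, LinearMap.mulRight_apply, controlled]
  rw [Finset.sum_comm]
  exact Finset.sum_congr rfl fun k _ => Finset.sum_congr rfl fun q _ => by ring

theorem hasGenerator_partialSwap {x : Fin M → Ket N} (hx : ∀ m, ‖x m‖ = 1) (m : Fin M) :
    HasGenerator (fun t => (partialSwap N t m).run x) (generator (controlled (ketbra (x m)))) :=
  hasGenerator_interact (sum_star_mul_self (hx m)) (norm_controlledSwap_le N)
    (interact₂_controlledSwap_left (x m)) (interact₂_controlledSwap_right (x m))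
    (norm_evolve_le (controlledSwap_isHermitian N))
    fun _ ht => norm_evolve_sub_le (norm_controlledSwap_le N) ht

end Data

/-! ### Composition of programs and counting of copies. -/

section Programs

variable {N M : ℕ}

theorem run_append (x : Fin M → Ket N) (p q : Program N M) :
    run x (p ++ q) = run x q * run x p := by
  -- The left fold is generalized to an arbitrary accumulator; induction from the end of the list
  -- matches its order of execution.
  have h : ∀ (q : Program N M) (Φ : Module.End ℂ (Matrix (Work N) (Work N) ℂ)),
      q.foldl (fun Φ i => i.run x ∘ₗ Φ) Φ = run x q * Φ := fun q => by
    induction q using List.reverseRecOn with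
    | nil => exact fun Φ => rfl
    | append_singleton q i ih =>
      intro Φ
      simp only [run, List.foldl_append, List.foldl_cons, List.foldl_nil] at ih ⊢
      rw [ih]
      rfl
  rw [run, List.foldl_append, h]
  rfl

theorem run_singleton (x : Fin M → Ket N) (i : Instr N M) : run x [i] = i.run x := rfl

theorem run_cons (x : Fin M → Ket N) (i : Instr N M) (p : Program N M) :
    run x (i :: p) = run x p * i.run x := run_append x [i] p

theorem run_flatten_replicate (x : Fin M → Ket N) (p : Program N M) (n : ℕ) :
    run x (List.replicate n p).flatten = run x p ^ n := by
  induction n with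
  | zero => rfl
  | succ n ih => rw [List.replicate_succ, List.flatten_cons, run_append, ih, pow_succ]

theorem copies_append (m : Fin M) (p q : Program N M) :
    copies m (p ++ q) = copies m p + copies m q := by
  simp [copies]

theorem copies_flatten_replicate (m : Fin M) (p : Program N M) (n : ℕ) :
    copies m (List.replicate n p).flatten = n * copies m p := by
  induction n with
  | zero => simp [copies]
  | succ n ih => rw [List.replicate_succ, List.flatten_cons, copies_append, ih]; ring

theorem copies_batch (m : Fin M) (Δt : ℝ) : copies m (batch N M Δt) = 1 := by
  simp [copies, batch, List.map_ofFn, List.sum_ofFn, Function.comp_def, partialSwap, Instr.copies]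

end Programs

/-! ### Accumulation of errors over swaps and batches. -/

section ErrorBounds

variable {a : Type*} [Fintype a] [DecidableEq a] {N M : ℕ}

theorem conjBy_mul (U V : Matrix a a ℂ) : conjBy (U * V) = conjBy U * conjBy V := by
  ext1 σ
  change U * V * σ * (U * V).conjTranspose = U * (V * σ * V.conjTranspose) * U.conjTranspose
  rw [Matrix.conjTranspose_mul]
  simp only [Matrix.mul_assoc]

theorem conjBy_one : conjBy (1 : Matrix a a ℂ) = 1 := by
  ext1 σ
  change 1 * σ * Matrix.conjTranspose 1 = σ
  rw [Matrix.conjTranspose_one, one_mul, mul_one]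

theorem conjBy_pow (U : Matrix a a ℂ) (n : ℕ) : conjBy (U ^ n) = conjBy U ^ n := by
  induction n with
  | zero => exact conjBy_one
  | succ n ih => rw [pow_succ, pow_succ, conjBy_mul, ih]

theorem isDiamondBound_conjBy {U : Matrix a a ℂ} (hU : U ∈ Matrix.unitaryGroup a ℂ) :
    IsDiamondBound (conjBy U) 1 := by
  have hτ : (Matrix.vecMulVec (1 : Unit → ℂ) (star 1)).trace = 1 := by simp [Matrix.trace]
  have h1 : ‖U ⊗ₖ (1 : Matrix Unit Unit ℂ)‖ ≤ 1 :=
    (norm_kronecker_one_le U).trans (norm_le_one_of_mem_unitaryGroup hU)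
  rw [conjBy_eq_interact U hτ]
  exact (isDiamondBound_interact₂ (by simp) _ _).mono (mul_le_one₀ h1 (norm_nonneg _) h1)

theorem IsDiamondBound.pow {Φ : Module.End ℂ (Matrix a a ℂ)} (h : IsDiamondBound Φ 1) (n : ℕ) :
    IsDiamondBound (Φ ^ n) 1 := by
  induction n with
  | zero => exact .one
  | succ n ih => rw [pow_succ]; simpa using ih.comp h zero_le_one

/-- Errors of contractions add up under iteration. -/
theorem IsDiamondBound.pow_sub_pow {Φ Ψ : Module.End ℂ (Matrix a a ℂ)} {c : ℝ}
    (hΦ : IsDiamondBound Φ 1) (hΨ : IsDiamondBound Ψ 1) (h : IsDiamondBound (Φ - Ψ) c)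
    (hc : 0 ≤ c) (n : ℕ) :
    IsDiamondBound (Φ ^ n - Ψ ^ n) (n * c) := by
  induction n with
  | zero => simpa using IsDiamondBound.zero (a := a)
  | succ n ih =>
    -- Telescoping: one step is exchanged at a time, and the surrounding contractions do not amplify
    -- its error.
    have e : Φ ^ (n + 1) - Ψ ^ (n + 1) = Φ ^ n * (Φ - Ψ) + (Φ ^ n - Ψ ^ n) * Ψ := by
      rw [pow_succ, pow_succ, mul_sub, sub_mul]
      abel
    rw [e]
    refine (((hΦ.pow n).comp h zero_le_one).add (ih.comp hΨ (by positivity))).mono (le_of_eq ?_)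
    push_cast
    ring

/-- The three bounds feed one induction: the remainder of a longer product needs contractivity and
the first-order bound for the shorter one. The total depends on `l.length * τ` alone, hence on `Δt`
and not on `M` for a batch. -/
theorem bounds_run_partialSwaps {x : Fin M → Ket N} (hx : ∀ m, ‖x m‖ = 1) (τ : ℝ)
    (l : List (Fin M)) :
    IsDiamondBound (run x (l.map (partialSwap N τ))) 1 ∧
    IsDiamondBound (run x (l.map (partialSwap N τ)) - 1) (l.length * (6 * |τ|)) ∧
    IsDiamondBound (run x (l.map (partialSwap N τ)) - 1 -
      (τ : ℂ) • (l.map fun m => generator (controlled (ketbra (x m)))).sum)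
      (6 * (l.length * τ) ^ 2) := by
  induction l with
  | nil =>
    have h0 : run x (([] : List (Fin M)).map (partialSwap N τ)) - 1 = 0 := sub_self _
    refine ⟨.one, ?_, ?_⟩
    · rw [h0]
      simpa using IsDiamondBound.zero
    · rw [h0]
      simpa using IsDiamondBound.zero
  | cons m l ih =>
    obtain ⟨ih1, ih2, ih3⟩ := ih
    have hm := hasGenerator_partialSwap hx m
    have hm1 := hm.bound_one τ
    have hm2 := hm.bound_sub_one τ
    have hm3 := hm.bound_remainder τ
    have hmL := hm.bound_generator.smul (τ : ℂ)
    rw [Complex.norm_real, Real.norm_eq_abs] at hmL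
    simp only [List.map_cons, run_cons, List.sum_cons, List.length_cons] at *
    set P := run x (l.map (partialSwap N τ))
    set Φ := (partialSwap N τ m).run x
    set L := generator (controlled (ketbra (x m)))
    set S := (l.map fun m => generator (controlled (ketbra (x m)))).sum
    refine ⟨by simpa using ih1.comp hm1 zero_le_one, ?_, ?_⟩
    · have e : P * Φ - 1 = P * (Φ - 1) + (P - 1) := by
        rw [mul_sub, mul_one]
        abel
      rw [e]
      refine ((ih1.comp hm2 zero_le_one).add ih2).mono (le_of_eq ?_)
      push_cast
      ring
    · have e : P * Φ - 1 - (τ : ℂ) • (L + S) =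
          P * (Φ - 1 - (τ : ℂ) • L) + (P - 1) * ((τ : ℂ) • L) + (P - 1 - (τ : ℂ) • S) := by
        rw [smul_add, mul_sub, mul_sub, mul_one, sub_mul, one_mul]
        abel
      rw [e]
      -- With `k` the length of `l`, the contributions are `4 τ²`, `12 k τ²` and `6 k² τ²`, together
      -- at most `6 (k + 1)² τ²`. The cross term uses up all of `12 k τ²`.
      refine (((ih1.comp hm3 zero_le_one).add (ih2.comp hmL (by positivity))).add ih3).mono ?_
      push_cast
      have hs := abs_mul_abs_self τ
      have e2 : (l.length : ℝ) * (6 * |τ|) * (|τ| * 2) = 12 * l.length * τ ^ 2 := by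
        rw [sq, ← hs]; ring
      rw [e2]
      nlinarith [sq_nonneg τ]

theorem sum_generator_eq (x : Fin M → Ket N) (hM : 0 < M) (Δt : ℝ) :
    ((Δt / M : ℝ) : ℂ) • ((List.finRange M).map fun m => generator (controlled (ketbra (x m)))).sum =
      (Δt : ℂ) • generator (controlled (ensemble x)) := by
  have hM' : (M : ℂ) ≠ 0 := by exact_mod_cast hM.ne'
  have hc : controlled (ensemble x) = (1 / M : ℂ) • ∑ m, controlled (ketbra (x m)) := by
    ext i j
    simp only [controlled, ensemble, Matrix.kroneckerMap_apply, Matrix.smul_apply, Matrix.sum_apply,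
      smul_eq_mul, Finset.mul_sum]
    exact Finset.sum_congr rfl fun _ _ => by ring
  have hl : ((List.finRange M).map fun m => generator (controlled (ketbra (x m)))).sum =
      ∑ m, generator (controlled (ketbra (x m))) := by
    rw [← List.ofFn_eq_map, List.sum_ofFn]
  rw [hl, hc]
  refine LinearMap.ext fun σ => ?_
  simp only [generator, LinearMap.smul_apply, LinearMap.sum_apply, LinearMap.sub_apply,
    LinearMap.mulLeft_apply, LinearMap.mulRight_apply, Finset.smul_sum, Finset.sum_mul,
    Finset.mul_sum, ← Finset.sum_sub_distrib, smul_smul, Matrix.smul_mul, Matrix.mul_smul,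
    ← smul_sub]
  refine Finset.sum_congr rfl fun m _ => ?_
  congr 1
  push_cast
  field_simp

theorem isHermitian_controlled_ensemble (x : Fin M → Ket N) :
    (controlled (ensemble x)).IsHermitian := controlled_isHermitian (ensemble_isHermitian x)

theorem isDiamondBound_run_batch {x : Fin M → Ket N} (hx : ∀ m, ‖x m‖ = 1) (Δt : ℝ) :
    IsDiamondBound (run x (batch N M Δt)) 1 := by
  rw [batch, List.ofFn_eq_map]
  exact (bounds_run_partialSwaps hx _ _).1

theorem isDiamondBound_batch_sub {x : Fin M → Ket N} (hM : 0 < M) (hx : ∀ m, ‖x m‖ = 1) (Δt : ℝ) :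
    IsDiamondBound (run x (batch N M Δt) - conjBy (evolve (controlled (ensemble x)) Δt))
      (10 * Δt ^ 2) := by
  have h1 := (bounds_run_partialSwaps hx (Δt / M) (List.finRange M)).2.2
  have h2 := (hasGenerator_conjBy_evolve (isHermitian_controlled_ensemble x)
    ((norm_controlled_le _).trans (norm_ensemble_le hx))).bound_remainder Δt
  rw [sum_generator_eq x hM] at h1
  have hM' : (M : ℝ) ≠ 0 := by exact_mod_cast hM.ne'
  rw [List.length_finRange, mul_div_cancel₀ _ hM'] at h1
  -- The common first-order part cancels, and the remainders give `6 + 4`.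
  have h3 := (h1.sub h2).mono (d := 10 * Δt ^ 2) (by linarith)
  rw [batch, List.ofFn_eq_map]
  convert h3 using 1
  abel

theorem commute_controlled_maxMixed (A : Op N) :
    Commute (controlled A) (controlled (maxMixed N)) := by
  rw [Commute, SemiconjBy, controlled, controlled, ← Matrix.mul_kronecker_mul,
    ← Matrix.mul_kronecker_mul, maxMixed]
  simp

theorem evolve_controlled_quantumHebbian (x : Fin M → Ket N) (t : ℝ) :
    evolve (controlled (quantumHebbian x)) t =
      evolve (controlled (ensemble x)) t * conditionalPhase N t := by
  rw [conditionalPhase, ← evolve_sub_of_commute (commute_controlled_maxMixed _)]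
  congr 1
  ext i j
  simp [controlled, quantumHebbian, mul_sub]

theorem commute_evolve_conditionalPhase (x : Fin M → Ket N) (t : ℝ) :
    Commute (evolve (controlled (ensemble x)) t) (conditionalPhase N t) :=
  ((commute_controlled_maxMixed _).smul_left _ |>.smul_right _).exp

theorem isDiamondBound_bcQSE {x : Fin M → Ket N} (hM : 0 < M) (hx : ∀ m, ‖x m‖ = 1) (t : ℝ)
    {n : ℕ} (hn : 1 ≤ n) :
    IsDiamondBound (run x (bcQSE N M t n) - conjBy (evolve (controlled (ensemble x)) t))
      (10 * t ^ 2 / n) := by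
  have hn' : (n : ℝ) ≠ 0 := by positivity
  have h := (isDiamondBound_run_batch hx (t / n)).pow_sub_pow (isDiamondBound_conjBy
    (evolve_mem_unitaryGroup (isHermitian_controlled_ensemble x) _))
    (isDiamondBound_batch_sub hM hx (t / n)) (by positivity) n
  rw [← conjBy_pow, evolve_pow, mul_div_cancel₀ _ hn'] at h
  rw [bcQSE, run_flatten_replicate]
  refine h.mono (le_of_eq ?_)
  field_simp

theorem conditionalPhase_mem_unitaryGroup (N : ℕ) (t : ℝ) :
    conditionalPhase N t ∈ Matrix.unitaryGroup (Work N) ℂ :=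
  evolve_mem_unitaryGroup (controlled_isHermitian (maxMixed_isHermitian N)) _

/-- A batch followed by its phase inherits the error of the batch, because the phase is unitary and
completes the evolution under `ρ` exactly to that under `W`. -/
theorem isDiamondBound_bcQSEWithPhase {x : Fin M → Ket N} (hM : 0 < M) (hx : ∀ m, ‖x m‖ = 1)
    (t : ℝ) {n : ℕ} (hn : 1 ≤ n) :
    IsDiamondBound (run x (bcQSEWithPhase N M t n) -
      conjBy (evolve (controlled (quantumHebbian x)) t)) (10 * t ^ 2 / n) := by
  have hn' : (n : ℝ) ≠ 0 := by positivity
  have hP := isDiamondBound_conjBy (conditionalPhase_mem_unitaryGroup N (t / n))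
  have hU := isDiamondBound_conjBy
    (evolve_mem_unitaryGroup (isHermitian_controlled_ensemble x) (t / n))
  have hB := isDiamondBound_run_batch hx (t / n)
  have hsub := hP.comp (isDiamondBound_batch_sub hM hx (t / n)) zero_le_one
  rw [mul_sub, ← conjBy_mul, ← (commute_evolve_conditionalPhase x _).eq,
    ← evolve_controlled_quantumHebbian, one_mul] at hsub
  have hPB := hP.comp hB zero_le_one
  have hPU := hP.comp hU zero_le_one
  rw [← conjBy_mul, ← (commute_evolve_conditionalPhase x _).eq,
    ← evolve_controlled_quantumHebbian] at hPU
  rw [one_mul] at hPB hPU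
  have h := hPB.pow_sub_pow hPU hsub (by positivity) n
  rw [← conjBy_pow, evolve_pow, mul_div_cancel₀ _ hn'] at h
  rw [bcQSEWithPhase, run_flatten_replicate, run_append, run_singleton]
  refine h.mono (le_of_eq ?_)
  field_simp

/-- The total phase is an evolution under `|1⟩⟨1| ⊗ 1` for the short time `-t / 2 ^ N`, hence within
`6 |t| / 2 ^ N` of the identity channel. -/
theorem isDiamondBound_bcQSE_sub_quantumHebbian {x : Fin M → Ket N} (hM : 0 < M)
    (hx : ∀ m, ‖x m‖ = 1) (t : ℝ) {n : ℕ} (hn : 1 ≤ n) :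
    IsDiamondBound (run x (bcQSE N M t n) - conjBy (evolve (controlled (quantumHebbian x)) t))
      (10 * (t ^ 2 / n + |t| / 2 ^ N)) := by
  have hphase : conditionalPhase N t = evolve (controlled (1 : Op N)) (-(t / 2 ^ N)) := by
    rw [conditionalPhase, evolve, evolve]
    congr 1
    ext i j
    simp [controlled, maxMixed]
    ring
  have h1 : ‖controlled (1 : Op N)‖ ≤ 1 := (norm_controlled_le _).trans norm_one_matrix_le
  have hP := (hasGenerator_conjBy_evolve (controlled_isHermitian (b := Basis N) Matrix.isHermitian_one)
    h1).bound_sub_one (-(t / 2 ^ N))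
  have hU := isDiamondBound_conjBy
    (evolve_mem_unitaryGroup (isHermitian_controlled_ensemble x) t)
  have h2 := (isDiamondBound_bcQSE hM hx t hn).sub (hU.comp hP zero_le_one)
  rw [mul_sub, ← hphase, ← conjBy_mul, ← evolve_controlled_quantumHebbian, mul_one] at h2
  have h3 : |(-(t / 2 ^ N))| = |t| / 2 ^ N := by
    rw [abs_neg, abs_div, abs_of_pos (by positivity : (0 : ℝ) < 2 ^ N)]
  rw [h3] at h2
  have h4 : 0 ≤ |t| / 2 ^ N := by positivity
  have h5 := h2.mono (d := 10 * (t ^ 2 / n + |t| / 2 ^ N)) (by rw [mul_div_assoc]; linarith)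
  convert h5 using 1
  abel

end ErrorBounds

/-! ### The classical Hebbian matrix and the form of the conditional phase. -/

section HebbianLearning

variable {N M : ℕ}

theorem quantumHebbian_encode (hM : 0 < M) (ξ : Fin M → Basis N → ℝ)
    (hξ : ∀ m i, ξ m i = 1 ∨ ξ m i = -1) :
    quantumHebbian (fun m => encode (ξ m)) = (classicalHebbian ξ).map Complex.ofReal := by
  have hM' : (M : ℝ) ≠ 0 := by exact_mod_cast hM.ne'
  ext i j
  have h1 : ∀ m, ketbra (encode (ξ m)) i j = ((ξ m i * ξ m j / 2 ^ N : ℝ) : ℂ) := fun m => by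
    simp only [ketbra, encode, Matrix.of_apply, RCLike.star_def, Complex.conj_ofReal]
    rw [← Complex.ofReal_mul, div_mul_div_comm, Real.mul_self_sqrt (by positivity)]
  have h2 : quantumHebbian (fun m => encode (ξ m)) i j =
      ((1 / M * ∑ m, ξ m i * ξ m j / 2 ^ N - 1 / 2 ^ N * (if i = j then 1 else 0) : ℝ) : ℂ) := by
    simp only [quantumHebbian, ensemble, maxMixed, Matrix.sub_apply, Matrix.smul_apply,
      Matrix.sum_apply, h1, Matrix.one_apply, smul_eq_mul]
    push_cast [apply_ite Complex.ofReal]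
    rfl
  rw [h2, Matrix.map_apply, classicalHebbian, Matrix.of_apply]
  congr 1
  split_ifs with h
  · subst h
    -- Entries `±1` make each diagonal entry of `ρ` equal to `1/d`, which is what subtracting `I/d`
    -- removes.
    have h3 : ∀ m, ξ m i * ξ m i = 1 := fun m => by rcases hξ m i with h | h <;> rw [h] <;> norm_num
    simp only [h3, Finset.sum_const, Finset.card_univ, Fintype.card_fin, nsmul_eq_mul]
    field_simp
    simp
  · rw [← Finset.sum_div]
    field_simp
    simp

/-- Half-angle splitting: with `φ = Δt/d`, `diag(1, e^{iφ}) = e^{iφ/2} diag(e^{-iφ/2}, e^{iφ/2})`.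
-/
theorem conditionalPhase_eq (N : ℕ) (Δt : ℝ) :
    conditionalPhase N Δt = (Complex.exp (Complex.I * Δt / (2 * 2 ^ N)) •
      evolve pauliZ (Δt / (2 * 2 ^ N))) ⊗ₖ (1 : Op N) := by
  have h1 : (-(Complex.I * ((-Δt : ℝ) : ℂ))) • controlled (maxMixed N) =
      Matrix.diagonal fun p : Work N => if p.1 = 1 then Complex.I * Δt / 2 ^ N else 0 := by
    ext ⟨i, p⟩ ⟨j, q⟩
    fin_cases i <;> fin_cases j <;> by_cases h : p = q <;>
      simp [controlled, maxMixed, h, div_eq_mul_inv]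
  have h2 : (-(Complex.I * ((Δt / (2 * 2 ^ N) : ℝ) : ℂ))) • pauliZ =
      Matrix.diagonal ((-(Complex.I * Δt / (2 * 2 ^ N)) : ℂ) • ![1, -1]) := by
    rw [pauliZ, ← Matrix.diagonal_smul]
    congr 1
    push_cast
    congr 2
    ring
  rw [conditionalPhase, evolve, evolve, h1, h2, Matrix.exp_diagonal, Matrix.exp_diagonal]
  ext ⟨i, p⟩ ⟨j, q⟩
  fin_cases i <;> fin_cases j <;> by_cases h : p = q <;>
    simp [h, Pi.exp_def, ← Complex.exp_eq_exp_ℂ,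
      ← Complex.exp_add]
  ring_nf

end HebbianLearning

end QHL

end

theorem mainTheorem6 :
    ∃ C : ℝ, 0 < C ∧ ∀ N M : ℕ, 0 < M →
      -- bcQSE with phases, using at most `C t² / ε + 1` batches, achieves QHL
      QHL.IsQHL (N := N) (M := M) QHL.quantumHebbian
        (fun t ε => QHL.bcQSEWithPhase N M t (max 1 ⌈C * t ^ 2 / ε⌉₊)) ∧
      -- `n` batches use `n` copies of each training state
      (∀ (t : ℝ) (n : ℕ) (m : Fin M),
        QHL.copies m (QHL.bcQSE N M t n) = n ∧ QHL.copies m (QHL.bcQSEWithPhase N M t n) = n) ∧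
      -- the conditional phase is a single-qubit phase and `Z` rotation of the learning qubit
      (∀ Δt : ℝ, QHL.conditionalPhase N Δt =
        Matrix.kroneckerMap (· * ·)
          (Complex.exp (Complex.I * Δt / (2 * 2 ^ N)) •
            QHL.evolve QHL.pauliZ (Δt / (2 * 2 ^ N)))
          (1 : QHL.Op N)) ∧
      ∀ x : Fin M → QHL.Ket N, (∀ m, ‖x m‖ = 1) →
        -- `ρ` is operationally accessible through bcQSE
        (∀ (t : ℝ) (n : ℕ), 1 ≤ n →
          QHL.diamondNorm (QHL.run x (QHL.bcQSE N M t n) -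
            QHL.conjBy (QHL.evolve (QHL.controlled (QHL.ensemble x)) t)) ≤
              ENNReal.ofReal (C * t ^ 2 / n)) ∧
        -- so is `W = ρ - I/d`, with a conditional phase in every batch
        (∀ (t : ℝ) (n : ℕ), 1 ≤ n →
          QHL.diamondNorm (QHL.run x (QHL.bcQSEWithPhase N M t n) -
            QHL.conjBy (QHL.evolve (QHL.controlled (QHL.quantumHebbian x)) t)) ≤
              ENNReal.ofReal (C * t ^ 2 / n)) ∧
        -- without the conditional phases there is an additional error `O(|t| / d)`
        (∀ (t : ℝ) (n : ℕ), 1 ≤ n →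
          QHL.diamondNorm (QHL.run x (QHL.bcQSE N M t n) -
            QHL.conjBy (QHL.evolve (QHL.controlled (QHL.quantumHebbian x)) t)) ≤
              ENNReal.ofReal (C * (t ^ 2 / n + |t| / 2 ^ N))) ∧
        -- `e^{-iΔt|1⟩⟨1|⊗W} = e^{-iΔt|1⟩⟨1|⊗ρ} e^{iΔt|1⟩⟨1|⊗I/d} + O(Δt²)` in operator norm
        (∀ Δt : ℝ,
          QHL.opNorm (QHL.evolve (QHL.controlled (QHL.quantumHebbian x)) Δt -
            QHL.evolve (QHL.controlled (QHL.ensemble x)) Δt * QHL.conditionalPhase N Δt) ≤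
              C * Δt ^ 2) := by
  refine ⟨10, by norm_num, fun N M hM => ⟨⟨QHL.quantumHebbian_encode hM, fun x hx t ε hε => ?_⟩,
    fun t n m => ⟨?_, ?_⟩, QHL.conditionalPhase_eq N, fun x hx => ⟨fun t n hn => ?_,
    fun t n hn => ?_, fun t n hn => ?_, fun Δt => ?_⟩⟩⟩
  -- The maximum with `1` matters at `t = 0`, where the ceiling vanishes but the error bound still
  -- requires a batch.
  · set n := max 1 ⌈10 * t ^ 2 / ε⌉₊
    have hn : 1 ≤ n := le_max_left _ _
    have hn' : (0 : ℝ) < n := by exact_mod_cast hn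
    have hle : 10 * t ^ 2 / ε ≤ n :=
      (Nat.le_ceil _).trans (Nat.cast_le.2 (le_max_right _ _))
    refine ((QHL.isDiamondBound_bcQSEWithPhase hM hx t hn).mono ?_).diamondNorm_le
    rw [div_le_iff₀ hε] at hle
    rw [div_le_iff₀ hn']
    linarith
  · rw [QHL.bcQSE, QHL.copies_flatten_replicate, QHL.copies_batch, mul_one]
  · rw [QHL.bcQSEWithPhase, QHL.copies_flatten_replicate, QHL.copies_append, QHL.copies_batch]
    exact mul_one n
  · exact (QHL.isDiamondBound_bcQSE hM hx t hn).diamondNorm_le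
  · exact (QHL.isDiamondBound_bcQSEWithPhase hM hx t hn).diamondNorm_le
  · exact (QHL.isDiamondBound_bcQSE_sub_quantumHebbian hM hx t hn).diamondNorm_le
  -- By commutation the splitting is exact, so the difference is zero and not merely of second
  -- order.
  · rw [QHL.evolve_controlled_quantumHebbian, sub_self, QHL.opNorm, map_zero, norm_zero]
    positivity
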